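/- Consider the M/M/$c$/$K$ retrial queue with two types of nonpersistent customers: primary customers arrive at rate $\lambda>0$; when $i$ customers are in the system (servers and waiting room) the total service rate is $\nu_i$, with $0=\nu_0<\nu_1\le\nu_2\le\cdots\le\nu_K$; an arriving primary customer enters the system if fewer than $K$ customers are in it, and otherwise joins the orbit with probability $p$ and is lost with probability $\bar p=1-p$; each customer in the orbit leaves it at rate $\mu>0$ and then retries with probability $r$ or abandons with probability $\bar r=1-r$; a retrying customer enters the system if fewer than $K$ customers are in it, and otherwise returns to the orbit with probability $q$ or is lost with probability $\bar q=1-q$ (where $p,q,r\in[0,1]$). Let $C(t)\in\{0,\dots,K\}$ and $N(t)\in\{0,1,2,\dots\}$ be the numbers of customers in the system and in the orbit at time $t$. Then $(C(t),N(t))$ is the continuous-time Markov chain whose transition rates out of the state $(i,n)$ are as follows. For $i<K$: $\lambda$ to $(i+1,n)$, $n\mu r$ to $(i+1,n-1)$, $n\mu\bar r$ to $(i,n-1)$. For $i=K$: $\lambda p$ to $(K,n+1)$, $n\mu(\bar r+r\bar q)$ to $(K,n-1)$. For $i\ge1$: $\nu_i$ to $(i-1,n)$. Assume that the chain is ergodic,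 and let $\pi_{i,n}=\lim_{t\to\infty}\Pr\{C(t)=i,\,N(t)=n\}$ be its stationary probabilities, so that $\sum_{i,n}\pi_{i,n}=1$. Suppose that $\bar r+r\bar q>0$ and put $$\gamma^{(0)}_1=\frac{\lambda p}{\mu(\bar r+r\bar q)}.$$ Then for every $k=1,2,\dots,K$ there exist $C^{(k)}_1>0$ and $C^{(k)}_2>0$, independent of $n$, such that for all $n\ge1$ $$C^{(k)}_1\,\frac{1}{n!}\,\bigl(\gamma^{(0)}_1\bigr)^n\, n^{-\frac{\nu_K}{\mu(\bar r+r\bar q)}-k}\;\le\;\pi_{K-k,n}\;\le\; C^{(k)}_2\,\frac{1}{n!}\,\bigl(\gamma^{(0)}_1\bigr)^n\, n^{-\frac{\nu_K}{\mu(\bar r+r\bar q)}-k}.$$ -/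

import Mathlib

open MeasureTheory Filter Topology
open scoped NNReal

/-- The parameters of an M/M/c/K retrial queue with two types of nonpersistent customers:
arrival rate `lam`, retrial rate `mu`, probability `p` that a blocked primary customer joins the
orbit, probability `q` that a blocked retrial customer rejoins the orbit, probability `r` that a
customer leaving the orbit retries, and total service rate `nu i` when `i` customers are in the
system (servers and waiting room). -/
structure RetrialQueue (K : ℕ) where
  lam : ℝ
  mu : ℝ
  p : ℝ
  q : ℝ
  r : ℝ
  nu : Fin (K + 1) → ℝ

namespace RetrialQueue

variable {K : ℕ}

/-- The probability `r̄ + r q̄` with which a customer departing from the orbit is lost when the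
system is fully occupied. -/
def lossProb (m : RetrialQueue K) : ℝ := (1 - m.r) + m.r * (1 - m.q)

/-- The coefficient `γ₁⁽⁰⁾ = λ p / (μ (r̄ + r q̄))`. -/
noncomputable def gamma (m : RetrialQueue K) : ℝ := m.lam * m.p / (m.mu * m.lossProb)

/-- The block `Q₀⁽ⁿ⁾`: transitions from level `n` to level `n + 1` (the level is the number of
customers in the orbit). -/
def Q0 (m : RetrialQueue K) (_n : ℕ) : Matrix (Fin (K + 1)) (Fin (K + 1)) ℝ :=
  Matrix.of fun i j => if i = Fin.last K ∧ j = Fin.last K then m.lam * m.p else 0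

/-- The block `Q₁⁽ⁿ⁾`: transitions within level `n`, and the diagonal of the generator. -/
def Q1 (m : RetrialQueue K) (n : ℕ) : Matrix (Fin (K + 1)) (Fin (K + 1)) ℝ :=
  Matrix.of fun i j =>
    if j.val = i.val + 1 then m.lam
    else if i.val = j.val + 1 then m.nu i
    else if i = j then
      if i = Fin.last K then -(m.lam * m.p + n * m.mu * m.lossProb + m.nu i)
      else -(m.lam + n * m.mu + m.nu i)
    else 0

/-- The block `Q₂⁽ⁿ⁾`: transitions from level `n` to level `n - 1`, for `n ≥ 1`. -/
def Q2 (m : RetrialQueue K) (n : ℕ) : Matrix (Fin (K + 1)) (Fin (K + 1)) ℝ :=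
  Matrix.of fun i j =>
    if j.val = i.val + 1 then n * m.mu * m.r
    else if i = j then
      if i = Fin.last K then n * m.mu * m.lossProb
      else n * m.mu * (1 - m.r)
    else 0

/-- The infinitesimal generator (block tridiagonal in the level). A state `(i, n)` means
`i` customers in the system and `n` in the orbit. -/
def Q (m : RetrialQueue K) (x y : Fin (K + 1) × ℕ) : ℝ :=
  if y.2 = x.2 + 1 then m.Q0 x.2 x.1 y.1
  else if y.2 = x.2 then m.Q1 x.2 x.1 y.1
  else if x.2 = y.2 + 1 then m.Q2 x.2 x.1 y.1
  else 0

/-- The function `Q f : x ↦ ∑ y, Q x y * f y`, for a finitely supported `f`. -/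
noncomputable def applyQ (m : RetrialQueue K) (f : (Fin (K + 1) × ℕ) →₀ ℝ)
    (x : Fin (K + 1) × ℕ) : ℝ :=
  f.sum fun y v => m.Q x y * v

/-- `X t = (C t, N t)` is a continuous-time Markov chain with generator `Q` (with respect to the
filtration `ℱ`), expressed by the martingale problem for `Q`: `X` is a measurable adapted process
and, for every finitely supported `f`, the process `f (X t) - ∫₀ᵗ (Q f) (X s) ds` is a martingale.
(For such an `f` the function `Q f` is again finitely supported. As the chain does not explode,
this problem is well posed, and its solutions are the Markov chains with generator `Q`.) -/
structure IsChain (m : RetrialQueue K) {Ω : Type*} [MeasurableSpace Ω] (P : Measure Ω)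
    (ℱ : Filtration ℝ≥0 ‹MeasurableSpace Ω›) (X : ℝ≥0 → Ω → Fin (K + 1) × ℕ) : Prop where
  measurable : Measurable fun z : ℝ≥0 × Ω => X z.1 z.2
  adapted : ∀ t, Measurable[ℱ t] (X t)
  martingale : ∀ f : (Fin (K + 1) × ℕ) →₀ ℝ,
    Martingale
      (fun (t : ℝ≥0) (ω : Ω) =>
        f (X t ω) - ∫ s in (0 : ℝ)..(t : ℝ), m.applyQ f (X s.toNNReal ω))
      ℱ P

end RetrialQueue

/-- `π i n = lim_{t → ∞} Pr {C t = i, N t = n}` for all `i` and `n`, where `X t = (C t, N t)`, and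
these limits form a probability distribution. -/
def IsLimitDistribution {K : ℕ} {Ω : Type*} [MeasurableSpace Ω] (P : Measure Ω)
    (X : ℝ≥0 → Ω → Fin (K + 1) × ℕ) (π : Fin (K + 1) → ℕ → ℝ) : Prop :=
  (∀ i n, Tendsto (fun t : ℝ≥0 => P.real {ω | X t ω = (i, n)}) atTop (𝓝 (π i n))) ∧
    HasSum (fun x : Fin (K + 1) × ℕ => π x.1 x.2) 1

/-! ### From the martingale problem to the balance equations. -/

namespace RetrialQueue

variable {K : ℕ}

/-! Write `f n` for the probability of a full system on level `n`, `S n` for the mass of the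
non-full states of that level, and `θ` for `lossProb`. The limit distribution solves the balance
equations, and two cuts of the state space drive the proof. The cut between levels (`level_eq`)
reads `λ p f n = (n+1) μ (θ f (n+1) + S (n+1))`. The cut around the non-full states of one level
(`partialMass_eq`) shows `n μ S n = ν_K f n + O(f n / n)`, since `S n = O(f n / n)` and `f (n+1) =
O(f n / n)`. Together they give `γ f n = (n+1) f (n+1) (1 + κ/(n+1) + O(1/n²))` with `κ = ν_K / (μ
θ)`. Taking logarithms and summing (`exists_bounds_of_recursion`), `f n` has the order of `γ^n
n^(-κ) / n!`. Each further free place costs a factor `1/n`: at least this order by the balance of a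
single state (`exists_lower`), at most this order by the cuts with fewer customers (`exists_upper`).
-/

lemma applyQ_single_one (m : RetrialQueue K) (x y : Fin (K + 1) × ℕ) :
    m.applyQ (Finsupp.single y 1) x = m.Q x y := by
  simp [applyQ]

/-- A jump changes the level by at most one, so every column of `Q` has finite support and the
balance equations are finite sums. -/
lemma Q_eq_zero_of_notMem (m : RetrialQueue K) {x y : Fin (K + 1) × ℕ}
    (hx : x ∉ (Finset.univ : Finset (Fin (K + 1))) ×ˢ Finset.range (y.2 + 2)) :
    m.Q x y = 0 := by
  simp only [Finset.mem_product, Finset.mem_univ, Finset.mem_range, true_and, not_lt] at hx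
  unfold Q
  rw [if_neg (by omega), if_neg (by omega), if_neg (by omega)]

/-- A function on a countable space that vanishes outside a finite set, composed with a random
variable, has an expectation given by a finite sum. -/
lemma integral_comp_eq_sum {Ω α : Type*} [MeasurableSpace Ω] [MeasurableSpace α]
    [MeasurableSingletonClass α] {P : Measure Ω} [IsProbabilityMeasure P]
    {Y : Ω → α} (hY : Measurable Y) {g : α → ℝ} {s : Finset α} (hg : ∀ x ∉ s, g x = 0) :
    ∫ ω, g (Y ω) ∂P = ∑ x ∈ s, g x * P.real {ω | Y ω = x} := by
  classical
  have h : ∀ ω, g (Y ω) = ∑ x ∈ s, Set.indicator {ω | Y ω = x} (fun _ => g x) ω := by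
    intro ω
    simp only [Set.indicator_apply, Set.mem_ofPred_eq]
    rw [Finset.sum_ite_eq]
    split_ifs with h
    · rfl
    · exact hg _ h
  have hm : ∀ x, MeasurableSet {ω | Y ω = x} := fun x => hY (measurableSet_singleton x)
  simp_rw [h]
  rw [integral_finsetSum]
  · refine Finset.sum_congr rfl fun x _ => ?_
    rw [integral_indicator_const _ (hm x), smul_eq_mul, mul_comm]
  · exact fun x _ => (integrable_const _).indicator (hm x)

/-- If the means of `G` over `[t, t + 1]` vanish as `t → ∞` and `G` converges, its limit is zero. -/
lemma eq_zero_of_tendsto_of_integral_tendsto {G : ℝ → ℝ} {L : ℝ}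
    (hG : Tendsto G atTop (𝓝 L)) (hi : ∀ a b, IntervalIntegrable G volume a b)
    (h0 : Tendsto (fun t => ∫ s in t..(t + 1), G s) atTop (𝓝 0)) : L = 0 := by
  refine tendsto_nhds_unique (f := fun t => ∫ s in t..(t + 1), G s) ?_ h0
  rw [Metric.tendsto_atTop]
  intro ε hε
  obtain ⟨T, hT⟩ := Metric.tendsto_atTop.1 hG (ε / 2) (half_pos hε)
  refine ⟨T, fun t ht => ?_⟩
  have h1 : (∫ s in t..(t + 1), G s) - L = ∫ s in t..(t + 1), (G s - L) := by
    rw [intervalIntegral.integral_sub (hi _ _) (by simp)]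
    simp
  rw [Real.dist_eq, h1, ← Real.norm_eq_abs]
  have h2 := intervalIntegral.norm_integral_le_of_norm_le_const (a := t) (b := t + 1)
    (f := fun s => G s - L) (C := ε / 2) (fun s hs => by
      rw [Set.uIoc_of_le (by linarith)] at hs
      exact (hT s (by linarith [hs.1])).le)
  simp only [add_sub_cancel_left, abs_one, mul_one] at h2
  linarith

/-- The forward equation of the chain, in integrated form. -/
lemma IsChain.integral_sum_eq {m : RetrialQueue K} {Ω : Type*} [MeasurableSpace Ω]
    {P : Measure Ω} [IsProbabilityMeasure P] {ℱ : Filtration ℝ≥0 ‹MeasurableSpace Ω›}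
    {X : ℝ≥0 → Ω → Fin (K + 1) × ℕ} (hX : m.IsChain P ℱ X) (y : Fin (K + 1) × ℕ) (t : ℝ≥0) :
    ∫ s in (0 : ℝ)..t, ∑ x ∈ (Finset.univ : Finset (Fin (K + 1))) ×ˢ Finset.range (y.2 + 2),
        m.Q x y * P.real {ω | X s.toNNReal ω = x} =
      P.real {ω | X t ω = y} - P.real {ω | X 0 ω = y} := by
  classical
  have hXt : ∀ t, Measurable (X t) := fun t => (hX.adapted t).mono (ℱ.le t) le_rfl
  -- Tested on the indicator of `y`, the generator becomes the column of `Q` at `y`.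
  have hM := hX.martingale (Finsupp.single y 1)
  simp only [applyQ_single_one] at hM
  have hprob : ∀ t, ∫ ω, (Finsupp.single y (1 : ℝ)) (X t ω) ∂P = P.real {ω | X t ω = y} := by
    intro t
    rw [integral_comp_eq_sum (hXt t) (g := Finsupp.single y (1 : ℝ)) (s := {y})]
    · simp
    · intro x hx
      exact Finsupp.single_eq_of_ne (by simpa using hx)
  -- Although `Q` is unbounded, a single column is bounded; this justifies Fubini below.
  obtain ⟨C, hC⟩ : ∃ C, ∀ x, ‖m.Q x y‖ ≤ C := by
    refine ⟨∑ x ∈ (Finset.univ : Finset (Fin (K + 1))) ×ˢ Finset.range (y.2 + 2), ‖m.Q x y‖,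
      fun x => ?_⟩
    by_cases hx : x ∈ (Finset.univ : Finset (Fin (K + 1))) ×ˢ Finset.range (y.2 + 2)
    · exact Finset.single_le_sum (f := fun x => ‖m.Q x y‖) (fun _ _ => norm_nonneg _) hx
    · rw [m.Q_eq_zero_of_notMem hx, norm_zero]
      exact Finset.sum_nonneg fun _ _ => norm_nonneg _
  have hmeas : Measurable fun z : ℝ × Ω => m.Q (X z.1.toNNReal z.2) y :=
    (measurable_of_countable fun x => m.Q x y).comp
      (hX.measurable.comp ((measurable_real_toNNReal.comp measurable_fst).prodMk measurable_snd))
  have hswap : ∫ ω, (∫ s in (0 : ℝ)..t, m.Q (X s.toNNReal ω) y) ∂P =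
      ∫ s in (0 : ℝ)..t, ∫ ω, m.Q (X s.toNNReal ω) y ∂P := by
    symm
    apply intervalIntegral_integral_swap
    have : IsFiniteMeasure (volume.restrict (Set.uIoc (0 : ℝ) t)) :=
      ⟨by simp [Set.uIoc]⟩
    refine Integrable.of_bound (C := C) hmeas.aestronglyMeasurable (ae_of_all _ fun z => hC _)
  have h1int : Integrable (fun ω => (Finsupp.single y (1 : ℝ)) (X t ω)) P :=
    Integrable.of_bound (C := 1)
      ((measurable_of_countable _).comp (hXt t)).aestronglyMeasurable
      (ae_of_all _ fun ω => by
        rw [Finsupp.single_apply]; split_ifs <;> simp)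
  have hint : Integrable (fun ω => ∫ s in (0 : ℝ)..t, m.Q (X s.toNNReal ω) y) P := by
    have := h1int.sub (hM.integrable t)
    refine this.congr (ae_of_all _ fun ω => ?_)
    simp
  have hE := hM.setIntegral_eq (show (0 : ℝ≥0) ≤ t from zero_le) MeasurableSet.univ
  simp only [Measure.restrict_univ, NNReal.coe_zero, intervalIntegral.integral_same, sub_zero] at hE
  rw [integral_sub h1int hint, hprob, hprob, hswap] at hE
  have hs : ∀ s : ℝ, ∫ ω, m.Q (X s.toNNReal ω) y ∂P =
      ∑ x ∈ (Finset.univ : Finset (Fin (K + 1))) ×ˢ Finset.range (y.2 + 2),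
        m.Q x y * P.real {ω | X s.toNNReal ω = x} := fun s =>
    integral_comp_eq_sum (hXt _) (g := fun x => m.Q x y) fun x hx => m.Q_eq_zero_of_notMem hx
  simp only [hs] at hE
  linarith

/-- The limit distribution of the chain satisfies the balance equations. -/
lemma IsChain.sum_Q_mul_eq_zero {m : RetrialQueue K} {Ω : Type*} [MeasurableSpace Ω]
    {P : Measure Ω} [IsProbabilityMeasure P] {ℱ : Filtration ℝ≥0 ‹MeasurableSpace Ω›}
    {X : ℝ≥0 → Ω → Fin (K + 1) × ℕ} (hX : m.IsChain P ℱ X) {π : Fin (K + 1) → ℕ → ℝ}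
    (hπ : IsLimitDistribution P X π) (y : Fin (K + 1) × ℕ) :
    ∑ x ∈ (Finset.univ : Finset (Fin (K + 1))) ×ˢ Finset.range (y.2 + 2),
      m.Q x y * π x.1 x.2 = 0 := by
  have hXt : ∀ t, Measurable (X t) := fun t => (hX.adapted t).mono (ℱ.le t) le_rfl
  set G : ℝ → ℝ := fun s =>
    ∑ x ∈ (Finset.univ : Finset (Fin (K + 1))) ×ˢ Finset.range (y.2 + 2),
        m.Q x y * P.real {ω | X s.toNNReal ω = x} with hGdef
  have hcoe : Tendsto Real.toNNReal atTop atTop := Real.tendsto_toNNReal_atTop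
  have hmeas : ∀ x, Measurable fun s : ℝ => P.real {ω | X s.toNNReal ω = x} := by
    intro x
    have hset : MeasurableSet {z : ℝ × Ω | X z.1.toNNReal z.2 = x} :=
      (hX.measurable.comp ((measurable_real_toNNReal.comp measurable_fst).prodMk measurable_snd))
        (measurableSet_singleton x)
    exact (measurable_measure_prodMk_left (ν := P) hset).ennreal_toReal
  have hi : ∀ a b, IntervalIntegrable G volume a b := by
    intro a b
    have hsum : G = ∑ x ∈ (Finset.univ : Finset (Fin (K + 1))) ×ˢ Finset.range (y.2 + 2),
        fun s : ℝ => m.Q x y * P.real {ω | X s.toNNReal ω = x} := by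
      ext s
      simp [hGdef]
    rw [hsum]
    refine IntervalIntegrable.sum _ fun x _ => ?_
    refine IntervalIntegrable.const_mul ?_ _
    refine (intervalIntegrable_const (c := (1 : ℝ))).mono_fun'
      (hmeas x).aestronglyMeasurable (ae_of_all _ fun s => ?_)
    simp only [Real.norm_of_nonneg measureReal_nonneg]
    exact measureReal_le_one
  refine eq_zero_of_tendsto_of_integral_tendsto (G := G) ?_ hi ?_
  · exact tendsto_finsetSum _ fun x _ => ((hπ.1 x.1 x.2).comp hcoe).const_mul _
  -- The integral of `G` over `[t, t + 1]` is the increment of the probability of `y`, which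
  -- vanishes as that probability converges.
  · have h1 := (hπ.1 y.1 y.2).comp hcoe
    have hshift : Tendsto (fun s : ℝ => s + 1) atTop atTop :=
      tendsto_atTop_add_const_right atTop (1 : ℝ) tendsto_id
    have h2 := h1.comp hshift
    have h3 := h2.sub h1
    rw [sub_self] at h3
    refine h3.congr' ?_
    filter_upwards [eventually_ge_atTop 0] with t ht
    have e1 := hX.integral_sum_eq y t.toNNReal
    have e2 := hX.integral_sum_eq y (t + 1).toNNReal
    rw [Real.coe_toNNReal _ ht] at e1
    rw [Real.coe_toNNReal _ (by linarith)] at e2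
    have e3 := intervalIntegral.integral_add_adjacent_intervals (hi 0 t) (hi t (t + 1))
    simp only [Function.comp]
    simp only [hGdef] at e3 ⊢
    linarith

end RetrialQueue

/-! ### The balance equations in coordinates. -/

namespace RetrialQueue

variable {K : ℕ}

/-- The balance equations of a retrial queue whose system has capacity `L + 1`, for weights `a i n`
and service rates `v i` indexed by natural numbers. -/
structure IsBalanced (L : ℕ) (lam mu p r θ : ℝ) (v : ℕ → ℝ) (a : ℕ → ℕ → ℝ) : Prop where
  empty : ∀ n : ℕ, (lam + n * mu) * a 0 n =
    v 1 * a 1 n + (n + 1) * mu * (1 - r) * a 0 (n + 1)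
  inner : ∀ i n : ℕ, i < L → (lam + n * mu + v (i + 1)) * a (i + 1) n =
    lam * a i n + v (i + 2) * a (i + 2) n + (n + 1) * mu * r * a i (n + 1) +
      (n + 1) * mu * (1 - r) * a (i + 1) (n + 1)
  full_zero : (lam * p + v (L + 1)) * a (L + 1) 0 =
    lam * a L 0 + mu * r * a L 1 + mu * θ * a (L + 1) 1
  full_succ : ∀ n : ℕ, (lam * p + (n + 1) * mu * θ + v (L + 1)) * a (L + 1) (n + 1) =
    lam * a L (n + 1) + lam * p * a (L + 1) n + (n + 2) * mu * r * a L (n + 2) +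
      (n + 2) * mu * θ * a (L + 1) (n + 2)

/-- A function on `Fin (K + 1)` extended by zero to the natural numbers. -/
noncomputable def extendFin (f : Fin (K + 1) → ℝ) (i : ℕ) : ℝ :=
  if h : i < K + 1 then f ⟨i, h⟩ else 0

lemma extendFin_of_lt (f : Fin (K + 1) → ℝ) {i : ℕ} (h : i < K + 1) :
    extendFin f i = f ⟨i, h⟩ := dif_pos h

@[simp] lemma extendFin_val (f : Fin (K + 1) → ℝ) (i : Fin (K + 1)) :
    extendFin f i = f i := extendFin_of_lt f i.2

/-- The total flow into a state on level `n + 1`, level by level. -/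
lemma sum_Q_mul_succ (m : RetrialQueue K) (π : Fin (K + 1) → ℕ → ℝ) (j : Fin (K + 1)) (n : ℕ) :
    ∑ x ∈ (Finset.univ : Finset (Fin (K + 1))) ×ˢ Finset.range (n + 1 + 2),
      m.Q x (j, n + 1) * π x.1 x.2 =
    ∑ i, m.Q0 n i j * π i n + ∑ i, m.Q1 (n + 1) i j * π i (n + 1) +
      ∑ i, m.Q2 (n + 2) i j * π i (n + 2) := by
  rw [Finset.sum_product_right, Finset.sum_range_succ, Finset.sum_range_succ,
    Finset.sum_range_succ, Finset.sum_eq_zero, zero_add]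
  · simp [Q]
  · intro k hk
    have hk := Finset.mem_range.1 hk
    refine Finset.sum_eq_zero fun i _ => ?_
    unfold Q
    rw [if_neg (by simp only; omega), if_neg (by simp only; omega), if_neg (by simp only; omega),
      zero_mul]

/-- The total flow into a state on level `0`, level by level. -/
lemma sum_Q_mul_zero (m : RetrialQueue K) (π : Fin (K + 1) → ℕ → ℝ) (j : Fin (K + 1)) :
    ∑ x ∈ (Finset.univ : Finset (Fin (K + 1))) ×ˢ Finset.range (0 + 2),
      m.Q x (j, 0) * π x.1 x.2 =
    ∑ i, m.Q1 0 i j * π i 0 + ∑ i, m.Q2 1 i j * π i 1 := by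
  rw [Finset.sum_product_right, Finset.sum_range_succ, Finset.sum_range_succ,
    Finset.sum_range_zero, zero_add]
  simp [Q]

lemma sum_Q0_mul (m : RetrialQueue K) (f : Fin (K + 1) → ℝ) (n : ℕ) (j : Fin (K + 1)) :
    ∑ i, m.Q0 n i j * f i = if j = Fin.last K then m.lam * m.p * f (Fin.last K) else 0 := by
  by_cases hj : j = Fin.last K <;> simp [Q0, hj]

/-- A sum over `Fin (K + 1)` whose coefficients vanish outside a finite set of indices. -/
lemma sum_mul_eq_sum_extendFin (f : Fin (K + 1) → ℝ) {c : Fin (K + 1) → ℝ} {g : ℕ → ℝ}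
    {s : Finset ℕ} (hc : ∀ i, c i = g i) (hs : ∀ i ∈ s, i < K + 1) (hg : ∀ i ∉ s, g i = 0) :
    ∑ i, c i * f i = ∑ i ∈ s, g i * extendFin f i := by
  rw [Finset.sum_subset (s₂ := Finset.range (K + 1)) (fun i hi => Finset.mem_range.2 (hs i hi))
    (fun i _ hi => by rw [hg i hi, zero_mul]),
    ← Fin.sum_univ_eq_sum_range (fun i => g i * extendFin f i)]
  simp [hc]

/-- Capacity `K + 1` keeps column `0` apart from the last one, whose diagonal entry has another
form. -/
lemma sum_Q1_mul_zero (m : RetrialQueue (K + 1)) (hnu0 : m.nu 0 = 0) (f : Fin (K + 2) → ℝ) (n : ℕ) :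
    ∑ i, m.Q1 n i ⟨0, by omega⟩ * f i =
      extendFin m.nu 1 * extendFin f 1 - (m.lam + n * m.mu) * extendFin f 0 := by
  rw [sum_mul_eq_sum_extendFin f (g := fun i : ℕ => if i = 1 then extendFin m.nu i
    else if i = 0 then -(m.lam + n * m.mu + extendFin m.nu i) else 0) (s := {1, 0})]
  · have h0 : extendFin m.nu 0 = 0 := (extendFin_val m.nu 0).trans hnu0
    simp [h0]
    ring
  · intro i
    simp only [Q1, Matrix.of_apply, Fin.ext_iff, Fin.val_last, extendFin_val]
    split_ifs <;> first | rfl | contradiction | omega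
  · intro i hi
    simp only [Finset.mem_insert, Finset.mem_singleton] at hi
    omega
  · intro i hi
    simp only [Finset.mem_insert, Finset.mem_singleton, not_or] at hi
    simp [hi]

lemma sum_Q2_mul_zero (m : RetrialQueue (K + 1)) (f : Fin (K + 2) → ℝ) (n : ℕ) :
    ∑ i, m.Q2 n i ⟨0, by omega⟩ * f i = n * m.mu * (1 - m.r) * extendFin f 0 := by
  rw [sum_mul_eq_sum_extendFin f
    (g := fun i : ℕ => if i = 0 then n * m.mu * (1 - m.r) else 0) (s := {0})]
  · simp
  · intro i
    simp only [Q2, Matrix.of_apply, Fin.ext_iff, Fin.val_last]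
    split_ifs <;> first | rfl | contradiction | omega
  · intro i hi
    simp only [Finset.mem_singleton] at hi
    omega
  · intro i hi
    simp only [Finset.mem_singleton] at hi
    simp [hi]

lemma sum_Q1_mul_inner (m : RetrialQueue (K + 1)) (f : Fin (K + 2) → ℝ) (n : ℕ) {j : ℕ}
    (hj : j < K) :
    ∑ i, m.Q1 n i ⟨j + 1, by omega⟩ * f i =
      m.lam * extendFin f j + extendFin m.nu (j + 2) * extendFin f (j + 2) -
        (m.lam + n * m.mu + extendFin m.nu (j + 1)) * extendFin f (j + 1) := by
  rw [sum_mul_eq_sum_extendFin f (g := fun i : ℕ => if i = j then m.lam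
    else if i = j + 2 then extendFin m.nu i
    else if i = j + 1 then -(m.lam + n * m.mu + extendFin m.nu i) else 0) (s := {j, j + 1, j + 2})]
  · simp
    ring
  · intro i
    have := i.2
    simp only [Q1, Matrix.of_apply, Fin.ext_iff, Fin.val_last, extendFin_val]
    split_ifs <;> first | rfl | omega
  · intro i hi
    simp only [Finset.mem_insert, Finset.mem_singleton] at hi
    omega
  · intro i hi
    simp only [Finset.mem_insert, Finset.mem_singleton, not_or] at hi
    simp [hi]

lemma sum_Q2_mul_inner (m : RetrialQueue (K + 1)) (f : Fin (K + 2) → ℝ) (n : ℕ) {j : ℕ}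
    (hj : j < K) :
    ∑ i, m.Q2 n i ⟨j + 1, by omega⟩ * f i =
      n * m.mu * m.r * extendFin f j + n * m.mu * (1 - m.r) * extendFin f (j + 1) := by
  rw [sum_mul_eq_sum_extendFin f (g := fun i : ℕ => if i = j then n * m.mu * m.r
    else if i = j + 1 then n * m.mu * (1 - m.r) else 0) (s := {j, j + 1})]
  · simp
  · intro i
    have := i.2
    simp only [Q2, Matrix.of_apply, Fin.ext_iff, Fin.val_last]
    split_ifs <;> first | rfl | omega
  · intro i hi
    simp only [Finset.mem_insert, Finset.mem_singleton] at hi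
    omega
  · intro i hi
    simp only [Finset.mem_insert, Finset.mem_singleton, not_or] at hi
    simp [hi]

lemma sum_Q1_mul_last (m : RetrialQueue (K + 1)) (f : Fin (K + 2) → ℝ) (n : ℕ) :
    ∑ i, m.Q1 n i (Fin.last (K + 1)) * f i =
      m.lam * extendFin f K -
        (m.lam * m.p + n * m.mu * m.lossProb + extendFin m.nu (K + 1)) * extendFin f (K + 1) := by
  rw [sum_mul_eq_sum_extendFin f (g := fun i : ℕ => if i = K then m.lam
    else if i = K + 1 then -(m.lam * m.p + n * m.mu * m.lossProb + extendFin m.nu i) else 0) (s := {K, K + 1})]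
  · simp
    ring
  · intro i
    have := i.2
    simp only [Q1, Matrix.of_apply, Fin.ext_iff, Fin.val_last, extendFin_val]
    split_ifs <;> first | rfl | omega
  · intro i hi
    simp only [Finset.mem_insert, Finset.mem_singleton] at hi
    omega
  · intro i hi
    simp only [Finset.mem_insert, Finset.mem_singleton, not_or] at hi
    simp [hi]

lemma sum_Q2_mul_last (m : RetrialQueue (K + 1)) (f : Fin (K + 2) → ℝ) (n : ℕ) :
    ∑ i, m.Q2 n i (Fin.last (K + 1)) * f i =
      n * m.mu * m.r * extendFin f K + n * m.mu * m.lossProb * extendFin f (K + 1) := by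
  rw [sum_mul_eq_sum_extendFin f (g := fun i : ℕ => if i = K then n * m.mu * m.r
    else if i = K + 1 then n * m.mu * m.lossProb else 0) (s := {K, K + 1})]
  · simp
  · intro i
    have := i.2
    simp only [Q2, Matrix.of_apply, Fin.ext_iff, Fin.val_last]
    split_ifs <;> first | rfl | omega
  · intro i hi
    simp only [Finset.mem_insert, Finset.mem_singleton] at hi
    omega
  · intro i hi
    simp only [Finset.mem_insert, Finset.mem_singleton, not_or] at hi
    simp [hi]

/-- Indexing by natural numbers allows induction on the number of customers. Level `0` is treated
separately because nothing flows in from below. -/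
lemma isBalanced_of_sum_Q_mul_eq_zero (m : RetrialQueue (K + 1)) (hnu0 : m.nu 0 = 0)
    {π : Fin (K + 2) → ℕ → ℝ}
    (h : ∀ y : Fin (K + 2) × ℕ,
      ∑ x ∈ (Finset.univ : Finset (Fin (K + 2))) ×ˢ Finset.range (y.2 + 2),
        m.Q x y * π x.1 x.2 = 0) :
    IsBalanced K m.lam m.mu m.p m.r m.lossProb (extendFin m.nu)
      (fun i n => extendFin (fun j => π j n) i) where
  empty n := by
    cases n with
    | zero =>
      have := h (⟨0, by omega⟩, 0)
      simp only [] at this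
      rw [sum_Q_mul_zero, sum_Q1_mul_zero m hnu0 (fun i => π i 0),
        sum_Q2_mul_zero m (fun i => π i 1)] at this
      push_cast at this ⊢
      linarith
    | succ n =>
      have := h (⟨0, by omega⟩, n + 1)
      simp only [] at this
      rw [sum_Q_mul_succ, sum_Q0_mul m (fun i => π i n), sum_Q1_mul_zero m hnu0 (fun i => π i (n + 1)),
        sum_Q2_mul_zero m (fun i => π i (n + 2)), if_neg (by simp [Fin.ext_iff])] at this
      push_cast at this ⊢
      linarith
  inner i n hi := by
    cases n with
    | zero =>
      have := h (⟨i + 1, by omega⟩, 0)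
      simp only [] at this
      rw [sum_Q_mul_zero, sum_Q1_mul_inner m (fun i => π i 0) _ hi,
        sum_Q2_mul_inner m (fun i => π i 1) _ hi] at this
      push_cast at this ⊢
      linarith
    | succ n =>
      have := h (⟨i + 1, by omega⟩, n + 1)
      simp only [] at this
      rw [sum_Q_mul_succ, sum_Q0_mul m (fun i => π i n), sum_Q1_mul_inner m (fun i => π i (n + 1)) _ hi,
        sum_Q2_mul_inner m (fun i => π i (n + 2)) _ hi,
        if_neg (by simp only [Fin.ext_iff, Fin.val_last]; omega)] at this
      push_cast at this ⊢
      linarith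
  full_zero := by
    have := h (Fin.last (K + 1), 0)
    simp only [] at this
    rw [sum_Q_mul_zero, sum_Q1_mul_last m (fun i => π i 0),
      sum_Q2_mul_last m (fun i => π i 1)] at this
    push_cast at this ⊢
    linarith
  full_succ n := by
    have := h (Fin.last (K + 1), n + 1)
    simp only [] at this
    rw [sum_Q_mul_succ, sum_Q0_mul m (fun i => π i n), sum_Q1_mul_last m (fun i => π i (n + 1)),
      sum_Q2_mul_last m (fun i => π i (n + 2)), if_pos rfl] at this
    have e : π (Fin.last (K + 1)) n = extendFin (fun j => π j n) (K + 1) :=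
      (extendFin_val (fun j => π j n) (Fin.last (K + 1))).symm
    rw [e] at this
    push_cast at this ⊢
    linarith

end RetrialQueue

/-! ### Cut equations, and comparison of each state with the full one. -/

namespace RetrialQueue

/-- The mass of the states of level `n` with at most `j` customers in the system. -/
def partialMass (a : ℕ → ℕ → ℝ) (j n : ℕ) : ℝ := ∑ i ∈ Finset.range (j + 1), a i n

lemma partialMass_succ (a : ℕ → ℕ → ℝ) (j n : ℕ) :
    partialMass a (j + 1) n = partialMass a j n + a (j + 1) n := Finset.sum_range_succ _ _

lemma partialMass_zero (a : ℕ → ℕ → ℝ) (n : ℕ) : partialMass a 0 n = a 0 n := by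
  simp [partialMass]

lemma partialMass_nonneg {a : ℕ → ℕ → ℝ} (ha : ∀ i n, 0 ≤ a i n) (j n : ℕ) :
    0 ≤ partialMass a j n := Finset.sum_nonneg fun _ _ => ha _ _

lemma le_partialMass {a : ℕ → ℕ → ℝ} (ha : ∀ i n, 0 ≤ a i n) {i j : ℕ} (hij : i ≤ j) (n : ℕ) :
    a i n ≤ partialMass a j n :=
  Finset.single_le_sum (f := fun i => a i n) (fun _ _ => ha _ _)
    (Finset.mem_range.2 (Nat.lt_succ_of_le hij))

namespace IsBalanced

variable {L : ℕ} {lam mu p r θ : ℝ} {v : ℕ → ℝ} {a : ℕ → ℕ → ℝ}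

/-- Balance of the flow through the set of states of level `n` with at most `j` customers in the
system. -/
lemma partialMass_eq (h : IsBalanced L lam mu p r θ v a) {j : ℕ} (hj : j ≤ L) (n : ℕ) :
    n * mu * partialMass a j n + lam * a j n =
      v (j + 1) * a (j + 1) n + (n + 1) * mu * partialMass a j (n + 1) -
        (n + 1) * mu * r * a j (n + 1) := by
  induction j with
  | zero =>
    have := h.empty n
    simp only [partialMass_zero, zero_add]
    linarith
  | succ j ih =>
    -- Adding the balance of state `j + 1` cancels the flow between `j` and `j + 1`.
    have h1 := ih (by omega)
    have h2 := h.inner j n (by omega)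
    rw [partialMass_succ, partialMass_succ]
    linarith

/-- Balance of the flow between the levels `n` and `n + 1`. -/
lemma level_eq (h : IsBalanced L lam mu p r θ v a) (n : ℕ) :
    lam * p * a (L + 1) n =
      (n + 1) * mu * (θ * a (L + 1) (n + 1) + partialMass a L (n + 1)) := by
  induction n with
  | zero =>
    have h1 := h.partialMass_eq le_rfl 0
    have h2 := h.full_zero
    push_cast at h1 ⊢
    simp only [zero_add] at *
    linarith
  | succ n ih =>
    -- The sum of these two equations balances all of level `n + 1`; `ih` removes its exchange with
    -- level `n`.
    have h1 := h.partialMass_eq le_rfl (n + 1)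
    have h2 := h.full_succ n
    push_cast at h1 ⊢
    linarith

/-- Both summands on the right of `level_eq` are nonnegative, so each obeys the bound alone;
`succ_mul_le` is the other half. -/
lemma succ_mul_partialMass_le (h : IsBalanced L lam mu p r θ v a) (hmu : 0 < mu) (hθ : 0 < θ)
    (ha : ∀ i n, 0 ≤ a i n) (n : ℕ) :
    (n + 1) * mu * partialMass a L (n + 1) ≤ lam * p * a (L + 1) n := by
  have h1 := h.level_eq n
  have h2 : 0 ≤ (n + 1) * mu * (θ * a (L + 1) (n + 1)) := by
    have := ha (L + 1) (n + 1)
    positivity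
  linarith

lemma succ_mul_le (h : IsBalanced L lam mu p r θ v a) (hmu : 0 < mu)
    (ha : ∀ i n, 0 ≤ a i n) (n : ℕ) :
    (n + 1) * mu * θ * a (L + 1) (n + 1) ≤ lam * p * a (L + 1) n := by
  have h1 := h.level_eq n
  have h2 : 0 ≤ (n + 1) * mu * partialMass a L (n + 1) := by
    have := partialMass_nonneg ha L (n + 1)
    positivity
  linarith

/-- If nobody joins the orbit, then the orbit is empty. -/
lemma eq_zero_of_full_eq_zero (h : IsBalanced L lam mu p r θ v a) (hmu : 0 < mu) (hθ : 0 < θ)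
    (ha : ∀ i n, 0 ≤ a i n) {n : ℕ} (h0 : lam * p * a (L + 1) n = 0) {i : ℕ} (hi : i ≤ L + 1) :
    a i (n + 1) = 0 := by
  have h1 := h.succ_mul_partialMass_le hmu hθ ha n
  have h2 := h.succ_mul_le hmu ha n
  rw [h0] at h1 h2
  have hn : (0 : ℝ) < (n + 1) * mu := by positivity
  refine le_antisymm ?_ (ha _ _)
  rcases hi.eq_or_lt with rfl | hi
  · exact nonpos_of_mul_nonpos_right h2 (mul_pos hn hθ)
  · exact (le_partialMass ha (by omega) _).trans (nonpos_of_mul_nonpos_right h1 hn)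

/-- The full system has positive probability on every level, unless there is no mass at all. -/
lemma full_pos (h : IsBalanced L lam mu p r θ v a) (hlam : 0 < lam) (hmu : 0 < mu) (hp : 0 < p)
    (hr0 : 0 ≤ r) (hθ : 0 < θ) (ha : ∀ i n, 0 ≤ a i n)
    (hne : ∃ i n, i ≤ L + 1 ∧ a i n ≠ 0) (n : ℕ) : 0 < a (L + 1) n := by
  induction n with
  | zero =>
    refine (ha _ _).lt_of_ne' fun h0 => ?_
    have hlev : ∀ n, ∀ i ≤ L + 1, a i (n + 1) = 0 := by
      intro n
      induction n with
      | zero => exact fun i hi => h.eq_zero_of_full_eq_zero hmu hθ ha (by rw [h0, mul_zero]) hi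
      | succ n ih =>
        exact fun i hi => h.eq_zero_of_full_eq_zero hmu hθ ha (by rw [ih _ le_rfl, mul_zero]) hi
    -- With level `1` empty, the cut equation on level `0` is `lam * a j 0 = v (j + 1) * a (j + 1)
    -- 0`, so zeros propagate down from the full state.
    have hdown : ∀ k ≤ L + 1, a (L + 1 - k) 0 = 0 := by
      intro k
      induction k with
      | zero => exact fun _ => h0
      | succ k ih =>
        intro hk
        have hj := h.partialMass_eq (j := L + 1 - (k + 1)) (by omega) 0
        have e : L + 1 - (k + 1) + 1 = L + 1 - k := by omega
        rw [e, ih (by omega)] at hj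
        have hz : partialMass a (L + 1 - (k + 1)) (0 + 1) = 0 :=
          Finset.sum_eq_zero fun i hi => hlev 0 i (by rw [Finset.mem_range] at hi; omega)
        rw [hz, hlev 0 _ (by omega)] at hj
        simp only [Nat.cast_zero, zero_mul, mul_zero, zero_add, sub_zero] at hj
        exact (mul_eq_zero.1 hj).resolve_left hlam.ne'
    obtain ⟨i, n, hi, hin⟩ := hne
    cases n with
    | zero =>
      apply hin
      have := hdown (L + 1 - i) (by omega)
      rwa [show L + 1 - (L + 1 - i) = i by omega] at this
    | succ n => exact hin (hlev n i hi)
  | succ n ih =>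
    refine (ha _ _).lt_of_ne' fun h0 => ?_
    have h1 := h.full_succ n
    rw [h0, mul_zero] at h1
    have h2 : 0 < lam * p * a (L + 1) n := by positivity
    have h3 := ha L (n + 1)
    have h4 := ha L (n + 2)
    have h5 := ha (L + 1) (n + 2)
    have h6 : 0 ≤ lam * a L (n + 1) + (n + 2) * mu * r * a L (n + 2) +
      (n + 2) * mu * θ * a (L + 1) (n + 2) := by positivity
    linarith

/-- `a i n` is at least of the order of `a (i + 1) n / n`. -/
lemma exists_lower_step (h : IsBalanced L lam mu p r θ v a) (hlam : 0 < lam) (hmu : 0 < mu)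
    (hr0 : 0 ≤ r) (hr1 : r ≤ 1) (hv : ∀ i, 0 ≤ v i) (ha : ∀ i n, 0 ≤ a i n) {i : ℕ} (hi : i ≤ L)
    (hvi : 0 < v (i + 1)) :
    ∃ c > 0, ∀ n : ℕ, 1 ≤ n → c * a (i + 1) n ≤ n * a i n := by
  -- One inflow into the state `(i, n)` is at most its whole outflow.
  have key : ∀ n : ℕ, v (i + 1) * a (i + 1) n ≤ (lam + n * mu + v i) * a i n := by
    intro n
    have hA := ha i (n + 1)
    have hr1' : 0 ≤ 1 - r := by linarith
    cases i with
    | zero =>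
      have h1 := h.empty n
      have h2 : 0 ≤ (n + 1) * mu * (1 - r) * a 0 (n + 1) := by positivity
      have h3 := mul_nonneg (hv 0) (ha 0 n)
      simp only [zero_add]
      linarith
    | succ i =>
      have h1 := h.inner i n (by omega)
      have hB := ha i (n + 1)
      have hC := ha i n
      have h2 : 0 ≤ (n + 1) * mu * (1 - r) * a (i + 1) (n + 1) := by positivity
      have h3 : 0 ≤ (n + 1) * mu * r * a i (n + 1) := by positivity
      have h4 : 0 ≤ lam * a i n := by positivity
      linarith
  have hD : 0 < lam + mu + v i := by linarith [hv i]
  refine ⟨v (i + 1) / (lam + mu + v i), div_pos hvi hD, fun n hn => ?_⟩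
  rw [div_mul_eq_mul_div, div_le_iff₀ hD]
  refine (key n).trans ?_
  have hn' : (1 : ℝ) ≤ n := by exact_mod_cast hn
  have hle : lam + n * mu + v i ≤ n * (lam + mu + v i) := by
    nlinarith [hv i]
  nlinarith [ha i n, mul_le_mul_of_nonneg_right hle (ha i n)]

/-- `a (L + 1 - k) n` is at least of the order of `a (L + 1) n / n ^ k`. -/
lemma exists_lower (h : IsBalanced L lam mu p r θ v a) (hlam : 0 < lam) (hmu : 0 < mu)
    (hr0 : 0 ≤ r) (hr1 : r ≤ 1) (hv : ∀ i, 0 ≤ v i) (hvpos : ∀ i ≤ L, 0 < v (i + 1))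
    (ha : ∀ i n, 0 ≤ a i n) {k : ℕ} (hk : k ≤ L + 1) :
    ∃ c > 0, ∀ n : ℕ, 1 ≤ n → c * a (L + 1) n ≤ n ^ k * a (L + 1 - k) n := by
  induction k with
  | zero => exact ⟨1, one_pos, fun n _ => by simp⟩
  | succ k ih =>
    obtain ⟨c, hc, hcn⟩ := ih (by omega)
    obtain ⟨d, hd, hdn⟩ := h.exists_lower_step hlam hmu hr0 hr1 hv ha (i := L + 1 - (k + 1))
      (by omega) (hvpos _ (by omega))
    rw [show L + 1 - (k + 1) + 1 = L + 1 - k by omega] at hdn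
    refine ⟨d * c, mul_pos hd hc, fun n hn => ?_⟩
    calc d * c * a (L + 1) n = d * (c * a (L + 1) n) := by ring
      _ ≤ d * (n ^ k * a (L + 1 - k) n) := mul_le_mul_of_nonneg_left (hcn n hn) hd.le
      _ = n ^ k * (d * a (L + 1 - k) n) := by ring
      _ ≤ n ^ k * (n * a (L + 1 - (k + 1)) n) := mul_le_mul_of_nonneg_left (hdn n hn) (by positivity)
      _ = n ^ (k + 1) * a (L + 1 - (k + 1)) n := by ring

/-- The states with at most `L - k` customers in the system have mass at most of the order of
`a (L + 1) n / n ^ (k + 1)` on level `n`. -/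
lemma exists_upper (h : IsBalanced L lam mu p r θ v a) (hlam : 0 < lam) (hmu : 0 < mu)
    (hp : 0 ≤ p) (hr0 : 0 ≤ r) (hθ : 0 < θ) (hv : ∀ i, 0 ≤ v i) (ha : ∀ i n, 0 ≤ a i n)
    {k : ℕ} (hk : k ≤ L) :
    ∃ C > 0, ∀ n : ℕ, 1 ≤ n → n ^ (k + 1) * partialMass a (L - k) n ≤ C * a (L + 1) n := by
  have step : ∀ j ≤ L, ∀ n : ℕ, n * mu * partialMass a j n ≤
      v (j + 1) * a (j + 1) n + (n + 1) * mu * partialMass a j (n + 1) := by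
    intro j hj n
    have h1 := h.partialMass_eq hj n
    have h2 := ha j n
    have h3 := ha j (n + 1)
    have h4 : 0 ≤ lam * a j n := by positivity
    have h5 : 0 ≤ (n + 1) * mu * r * a j (n + 1) := by positivity
    linarith
  induction k with
  | zero =>
    -- The `+ 1` only makes the constant positive.
    refine ⟨(v (L + 1) + lam * p) / mu + 1, ?_, fun n hn => ?_⟩
    · have := hv (L + 1)
      positivity
    · have h1 := step L le_rfl n
      have h2 := h.succ_mul_partialMass_le hmu hθ ha n
      have h3 : n * partialMass a L n ≤ (v (L + 1) + lam * p) / mu * a (L + 1) n := by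
        rw [div_mul_eq_mul_div, le_div_iff₀ hmu]
        linarith
      simp only [zero_add, pow_one, Nat.sub_zero]
      linarith [ha (L + 1) n]
  | succ k ih =>
    obtain ⟨C, hC, hCn⟩ := ih (by omega)
    have e : L - (k + 1) + 1 = L - k := by omega
    refine ⟨(v (L - k) * C + C * (lam * p) / θ) / mu + 1, ?_, fun n hn => ?_⟩
    · have := hv (L - k)
      positivity
    · have h1 := step (L - (k + 1)) (by omega) n
      rw [e] at h1
      have hmono : ∀ n, partialMass a (L - (k + 1)) n + a (L - k) n = partialMass a (L - k) n := by
        intro n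
        rw [← e, partialMass_succ]
      have h2 : n ^ (k + 1) * a (L - k) n ≤ C * a (L + 1) n := by
        refine le_trans ?_ (hCn n hn)
        gcongr
        exact le_partialMass ha le_rfl n
      -- The inflow from level `n + 1` is controlled by the induction hypothesis there; its factor
      -- `n + 1` is absorbed by `succ_mul_le`.
      have h3 : (n : ℝ) ^ (k + 1) * partialMass a (L - (k + 1)) (n + 1) ≤
          C * a (L + 1) (n + 1) := by
        have h4 := hCn (n + 1) (by omega)
        have h5 := hmono (n + 1)
        have h6 := ha (L - k) (n + 1)
        refine le_trans ?_ h4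
        have h7 := partialMass_nonneg ha (L - (k + 1)) (n + 1)
        gcongr
        · linarith
        · linarith
      have h4 := h.succ_mul_le hmu ha n
      have h5 : (n + 1) * mu * a (L + 1) (n + 1) ≤ lam * p * a (L + 1) n / θ := by
        rw [le_div_iff₀ hθ]
        linarith
      have h6 : n ^ (k + 1 + 1) * partialMass a (L - (k + 1)) n * mu ≤
          (v (L - k) * C + C * (lam * p) / θ) * a (L + 1) n := by
        calc n ^ (k + 1 + 1) * partialMass a (L - (k + 1)) n * mu
            = n ^ (k + 1) * (n * mu * partialMass a (L - (k + 1)) n) := by ring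
          _ ≤ n ^ (k + 1) * (v (L - k) * a (L - k) n +
                (n + 1) * mu * partialMass a (L - (k + 1)) (n + 1)) := by gcongr
          _ = v (L - k) * (n ^ (k + 1) * a (L - k) n) +
                (n + 1) * mu * (n ^ (k + 1) * partialMass a (L - (k + 1)) (n + 1)) := by ring
          _ ≤ v (L - k) * (C * a (L + 1) n) + (n + 1) * mu * (C * a (L + 1) (n + 1)) := by
                have := hv (L - k)
                gcongr
          _ = v (L - k) * (C * a (L + 1) n) + C * ((n + 1) * mu * a (L + 1) (n + 1)) := by ring
          _ ≤ v (L - k) * (C * a (L + 1) n) + C * (lam * p * a (L + 1) n / θ) := by gcongr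
          _ = _ := by ring
      have h7 : n ^ (k + 1 + 1) * partialMass a (L - (k + 1)) n ≤
          (v (L - k) * C + C * (lam * p) / θ) / mu * a (L + 1) n := by
        rw [div_mul_eq_mul_div, le_div_iff₀ hmu]
        exact h6
      linarith [ha (L + 1) n]

end IsBalanced

end RetrialQueue

/-! ### Asymptotics of a first-order recursion. -/

/-- The lower bound rests on `1 - 1/(1+x) = x - x² + x³/(1+x)`. -/
lemma abs_log_one_add_sub_le {x : ℝ} (hx : 0 ≤ x) : |Real.log (1 + x) - x| ≤ x ^ 2 := by
  have h1 := Real.log_le_sub_one_of_pos (show 0 < 1 + x by linarith)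
  have h2 := Real.one_sub_inv_le_log_of_pos (show 0 < 1 + x by linarith)
  have h3 : 1 - (1 + x)⁻¹ - (x - x ^ 2) = x ^ 3 / (1 + x) := by
    field_simp
    ring
  have h4 : 0 ≤ x ^ 3 / (1 + x) := by positivity
  rw [abs_le]
  constructor <;> nlinarith [sq_nonneg x]

lemma abs_sum_inv_sub_log_le {n : ℕ} (hn : 1 ≤ n) :
    |∑ k ∈ Finset.range n, ((k : ℝ) + 1)⁻¹ - Real.log n| ≤ 1 := by
  have e : ((harmonic n : ℚ) : ℝ) = ∑ k ∈ Finset.range n, ((k : ℝ) + 1)⁻¹ := by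
    simp [harmonic]
  have h1 := log_add_one_le_harmonic n
  have h2 := harmonic_le_one_add_log n
  have hn' : (0 : ℝ) < n := by exact_mod_cast hn
  have h3 : Real.log n ≤ Real.log ↑(n + 1) := Real.log_le_log hn' (by push_cast; linarith)
  rw [← e, abs_le]
  constructor <;> linarith

lemma exists_sum_inv_sq_le : ∃ C : ℝ, ∀ n, ∑ k ∈ Finset.range n, (((k : ℝ) + 1) ^ 2)⁻¹ ≤ C := by
  have h : Summable fun k : ℕ => (((k : ℝ) + 1) ^ 2)⁻¹ := by
    have := (summable_nat_add_iff 1).2 (Real.summable_nat_pow_inv.2 one_lt_two)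
    simpa using this
  exact ⟨_, fun n => h.sum_le_tsum _ fun k _ => by positivity⟩

/-- If `x n = κ / n + O(1 / n ^ 2)`, then `∑ log (1 + x k)` is `κ log n` up to a bounded error. -/
lemma exists_abs_sum_log_sub_le {x : ℕ → ℝ} {κ C : ℝ} (hκ : 0 ≤ κ) (hx : ∀ n, 0 ≤ x n)
    (hC : ∀ n, |x n - κ * ((n : ℝ) + 1)⁻¹| ≤ C * (((n : ℝ) + 1) ^ 2)⁻¹) :
    ∃ D, ∀ n : ℕ, 1 ≤ n →
      |∑ k ∈ Finset.range n, Real.log (1 + x k) - κ * Real.log n| ≤ D := by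
  obtain ⟨S, hS⟩ := exists_sum_inv_sq_le
  have hC0 : 0 ≤ C := by
    have := (abs_nonneg _).trans (hC 0)
    simpa using this
  have hterm : ∀ k : ℕ, |Real.log (1 + x k) - κ * ((k : ℝ) + 1)⁻¹| ≤
      ((κ + C) ^ 2 + C) * (((k : ℝ) + 1) ^ 2)⁻¹ := by
    intro k
    have h1 := abs_log_one_add_sub_le (hx k)
    have hk : (((k : ℝ) + 1) ^ 2)⁻¹ ≤ ((k : ℝ) + 1)⁻¹ := by
      have : (0 : ℝ) ≤ k := k.cast_nonneg
      gcongr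
      nlinarith
    have h2 : x k ≤ (κ + C) * ((k : ℝ) + 1)⁻¹ := by
      have := (abs_le.1 (hC k)).2
      nlinarith
    have h3 : x k ^ 2 ≤ (κ + C) ^ 2 * (((k : ℝ) + 1) ^ 2)⁻¹ := by
      rw [← inv_pow, ← mul_pow]
      exact pow_le_pow_left₀ (hx k) h2 2
    calc |Real.log (1 + x k) - κ * ((k : ℝ) + 1)⁻¹|
        ≤ |Real.log (1 + x k) - x k| + |x k - κ * ((k : ℝ) + 1)⁻¹| := abs_sub_le _ _ _
      _ ≤ (κ + C) ^ 2 * (((k : ℝ) + 1) ^ 2)⁻¹ + C * (((k : ℝ) + 1) ^ 2)⁻¹ :=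
          add_le_add (h1.trans h3) (hC k)
      _ = _ := by ring
  -- The first term sums the quadratic errors; `κ` pays for replacing the harmonic sum by `log n`.
  refine ⟨((κ + C) ^ 2 + C) * S + κ, fun n hn => ?_⟩
  have h1 : |∑ k ∈ Finset.range n, Real.log (1 + x k) -
      κ * ∑ k ∈ Finset.range n, ((k : ℝ) + 1)⁻¹| ≤ ((κ + C) ^ 2 + C) * S := by
    rw [Finset.mul_sum, ← Finset.sum_sub_distrib]
    refine (Finset.abs_sum_le_sum_abs _ _).trans ((Finset.sum_le_sum fun k _ => hterm k).trans ?_)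
    rw [← Finset.mul_sum]
    gcongr
    exact hS n
  have h2 : |κ * ∑ k ∈ Finset.range n, ((k : ℝ) + 1)⁻¹ - κ * Real.log n| ≤ κ := by
    rw [← mul_sub, abs_mul, abs_of_nonneg hκ]
    exact mul_le_of_le_one_right hκ (abs_sum_inv_sub_log_le hn)
  exact (abs_sub_le _ _ _).trans (add_le_add h1 h2)

/-- A positive solution of `γ A n = (n + 1) A (n + 1) (1 + κ / (n + 1) + O(1 / n ^ 2))` has the
order of `γ ^ n n ^ (-κ) / n!`. -/
lemma exists_bounds_of_recursion {A x : ℕ → ℝ} {κ C γ : ℝ} (hκ : 0 ≤ κ) (hγ : 0 < γ)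
    (hA : ∀ n, 0 < A n) (hx : ∀ n, 0 ≤ x n)
    (hrec : ∀ n : ℕ, γ * A n = (n + 1) * A (n + 1) * (1 + x n))
    (hC : ∀ n, |x n - κ * ((n : ℝ) + 1)⁻¹| ≤ C * (((n : ℝ) + 1) ^ 2)⁻¹) :
    ∃ c₁ c₂ : ℝ, 0 < c₁ ∧ 0 < c₂ ∧ ∀ n : ℕ, 1 ≤ n →
      c₁ * (1 / (n.factorial : ℝ) * γ ^ n * (n : ℝ) ^ (-κ)) ≤ A n ∧
      A n ≤ c₂ * (1 / (n.factorial : ℝ) * γ ^ n * (n : ℝ) ^ (-κ)) := by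
  obtain ⟨D, hD⟩ := exists_abs_sum_log_sub_le hκ hx hC
  -- In logarithms the recursion telescopes.
  have hlog : ∀ n : ℕ, Real.log (A n) = Real.log (A 0) + n * Real.log γ -
      Real.log n.factorial - ∑ k ∈ Finset.range n, Real.log (1 + x k) := by
    intro n
    induction n with
    | zero => simp
    | succ n ih =>
      have h1 := congrArg Real.log (hrec n)
      have hn : (n : ℝ) + 1 ≠ 0 := by positivity
      have hf : (n.factorial : ℝ) ≠ 0 := by positivity
      have hx' : 1 + x n ≠ 0 := by linarith [hx n]
      rw [Real.log_mul hγ.ne' (hA n).ne', Real.log_mul (mul_ne_zero hn (hA _).ne') hx',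
        Real.log_mul hn (hA _).ne'] at h1
      rw [Finset.sum_range_succ, Nat.factorial_succ]
      push_cast
      rw [Real.log_mul hn hf]
      linarith
  refine ⟨Real.exp (Real.log (A 0) - D), Real.exp (Real.log (A 0) + D), Real.exp_pos _,
    Real.exp_pos _, fun n hn => ?_⟩
  have hn' : (0 : ℝ) < n := by exact_mod_cast hn
  have hw : 1 / (n.factorial : ℝ) * γ ^ n * (n : ℝ) ^ (-κ) =
      Real.exp (n * Real.log γ - Real.log n.factorial - κ * Real.log n) := by
    have hf : (0 : ℝ) < n.factorial := by positivity
    rw [Real.exp_sub, Real.exp_sub, Real.exp_nat_mul, Real.exp_log hγ, Real.exp_log hf,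
      Real.rpow_def_of_pos hn', mul_neg, Real.exp_neg, mul_comm (Real.log n)]
    field_simp
  have hDn := abs_le.1 (hD n hn)
  have hAn := hlog n
  rw [hw, ← Real.exp_add, ← Real.exp_add]
  constructor
  · rw [← Real.le_log_iff_exp_le (hA n)]
    linarith
  · rw [← Real.log_le_iff_le_exp (hA n)]
    linarith

/-! ### Two-sided bounds for the full system, then for `k` free places. -/

namespace RetrialQueue.IsBalanced

variable {L : ℕ} {lam mu p r θ : ℝ} {v : ℕ → ℝ} {a : ℕ → ℕ → ℝ}

/-- `partialMass a L n = v (L + 1) / (mu n) * a (L + 1) n * (1 + O(1 / n))`. -/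
lemma exists_abs_partialMass_sub_le (h : IsBalanced L lam mu p r θ v a) (hlam : 0 < lam)
    (hmu : 0 < mu) (hp : 0 ≤ p) (hr0 : 0 ≤ r) (hr1 : r ≤ 1) (hθ : 0 < θ) (hv : ∀ i, 0 ≤ v i)
    (ha : ∀ i n, 0 ≤ a i n) :
    ∃ C, ∀ n : ℕ, 1 ≤ n →
      n * |n * mu * partialMass a L n - v (L + 1) * a (L + 1) n| ≤ C * a (L + 1) n := by
  obtain ⟨C, hC, hCn⟩ := h.exists_upper hlam hmu hp hr0 hθ hv ha (k := 0) (Nat.zero_le _)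
  simp only [zero_add, pow_one, Nat.sub_zero] at hCn
  refine ⟨C * (lam * p) / θ + lam * C, fun n hn => ?_⟩
  have h1 := h.partialMass_eq le_rfl n
  have h2 := h.succ_mul_le hmu ha n
  have h3 : n * (lam * a L n) ≤ lam * C * a (L + 1) n := by
    have := hCn n hn
    have h4 := le_partialMass ha (le_refl L) n
    calc n * (lam * a L n) = lam * (n * a L n) := by ring
      _ ≤ lam * (n * partialMass a L n) := by gcongr
      _ ≤ lam * (C * a (L + 1) n) := by gcongr
      _ = _ := by ring
  have h5 : n * ((n + 1) * mu * partialMass a L (n + 1)) ≤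
      C * (lam * p) / θ * a (L + 1) n := by
    have h6 := hCn (n + 1) (by omega)
    push_cast at h6
    have h7 : 0 ≤ (n + 1) * partialMass a L (n + 1) := by
      have := partialMass_nonneg ha L (n + 1)
      positivity
    rw [div_mul_eq_mul_div, le_div_iff₀ hθ]
    calc n * ((n + 1) * mu * partialMass a L (n + 1)) * θ
        = n * mu * θ * ((n + 1) * partialMass a L (n + 1)) := by ring
      _ ≤ (n + 1) * mu * θ * (C * a (L + 1) (n + 1)) := by
          gcongr
          linarith
      _ = C * ((n + 1) * mu * θ * a (L + 1) (n + 1)) := by ring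
      _ ≤ C * (lam * p * a (L + 1) n) := by gcongr
      _ = _ := by ring
  -- As `r ≤ 1`, the net inflow from level `n + 1` lies between `0` and `(n + 1) * mu * partialMass
  -- a L (n + 1)`.
  have h8 : (n + 1) * mu * r * a L (n + 1) ≤ (n + 1) * mu * partialMass a L (n + 1) := by
    have h9 := le_partialMass ha (le_refl L) (n + 1)
    have h10 := ha L (n + 1)
    calc (n + 1) * mu * r * a L (n + 1) ≤ (n + 1) * mu * 1 * a L (n + 1) := by gcongr
      _ = (n + 1) * mu * a L (n + 1) := by ring
      _ ≤ _ := by gcongr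
  have h11 : 0 ≤ (n + 1) * mu * r * a L (n + 1) := by
    have := ha L (n + 1)
    positivity
  have h12 : 0 ≤ lam * a L n := by
    have := ha L n
    positivity
  have h13 : |n * mu * partialMass a L n - v (L + 1) * a (L + 1) n| ≤
      (n + 1) * mu * partialMass a L (n + 1) + lam * a L n := by
    rw [abs_le]
    constructor <;> linarith
  calc n * |n * mu * partialMass a L n - v (L + 1) * a (L + 1) n|
      ≤ n * ((n + 1) * mu * partialMass a L (n + 1) + lam * a L n) := by gcongr
    _ ≤ _ := by linarith

/-- The order of the probabilities of the full system. -/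
lemma exists_full_bounds (h : IsBalanced L lam mu p r θ v a) (hlam : 0 < lam)
    (hmu : 0 < mu) (hp : 0 < p) (hr0 : 0 ≤ r) (hr1 : r ≤ 1) (hθ : 0 < θ) (hv : ∀ i, 0 ≤ v i)
    (ha : ∀ i n, 0 ≤ a i n) (hpos : ∀ n, 0 < a (L + 1) n) :
    ∃ c₁ c₂ : ℝ, 0 < c₁ ∧ 0 < c₂ ∧ ∀ n : ℕ, 1 ≤ n →
      c₁ * (1 / (n.factorial : ℝ) * (lam * p / (mu * θ)) ^ n *
        (n : ℝ) ^ (-(v (L + 1) / (mu * θ)))) ≤ a (L + 1) n ∧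
      a (L + 1) n ≤ c₂ * (1 / (n.factorial : ℝ) * (lam * p / (mu * θ)) ^ n *
        (n : ℝ) ^ (-(v (L + 1) / (mu * θ)))) := by
  obtain ⟨C, hC⟩ := h.exists_abs_partialMass_sub_le hlam hmu hp.le hr0 hr1 hθ hv ha
  -- This is `level_eq` divided by `mu * θ`, with `θ * a (L + 1) (n + 1)` factored out; `x n`
  -- belongs to level `n + 1`.
  refine exists_bounds_of_recursion (A := a (L + 1))
    (x := fun n => partialMass a L (n + 1) / (θ * a (L + 1) (n + 1))) (C := C / (mu * θ))
    (div_nonneg (hv _) (by positivity)) (by positivity) hpos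
    (fun n => div_nonneg (partialMass_nonneg ha _ _) (mul_pos hθ (hpos _)).le)
    (fun n => ?_) (fun n => ?_)
  · have h1 := h.level_eq n
    have h2 := (hpos (n + 1)).ne'
    field_simp
    linarith
  · have h1 := hC (n + 1) (by omega)
    push_cast at h1
    have h2 := hpos (n + 1)
    have h3 : partialMass a L (n + 1) / (θ * a (L + 1) (n + 1)) -
        v (L + 1) / (mu * θ) * ((n : ℝ) + 1)⁻¹ =
        ((n + 1) * mu * partialMass a L (n + 1) - v (L + 1) * a (L + 1) (n + 1)) /
          (mu * θ * (n + 1) * a (L + 1) (n + 1)) := by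
      field_simp
    have h4 : 0 < mu * θ * (n + 1) * a (L + 1) (n + 1) := by positivity
    rw [h3, abs_div, abs_of_pos h4, div_le_iff₀ h4]
    have h5 : C / (mu * θ) * (((n : ℝ) + 1) ^ 2)⁻¹ * (mu * θ * (n + 1) * a (L + 1) (n + 1)) =
        C * a (L + 1) (n + 1) / (n + 1) := by
      field_simp
    rw [h5, le_div_iff₀ (by positivity)]
    linarith

/-- The order of the probabilities of the system with `k` free places. -/
lemma exists_bounds (h : IsBalanced L lam mu p r θ v a) (hlam : 0 < lam)
    (hmu : 0 < mu) (hp : 0 ≤ p) (hr0 : 0 ≤ r) (hr1 : r ≤ 1) (hθ : 0 < θ) (hv : ∀ i, 0 ≤ v i)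
    (hvpos : ∀ i ≤ L, 0 < v (i + 1)) (ha : ∀ i n, 0 ≤ a i n)
    (hne : ∃ i n, i ≤ L + 1 ∧ a i n ≠ 0) {k : ℕ} (hk1 : 1 ≤ k) (hk : k ≤ L + 1) :
    ∃ C₁ C₂ : ℝ, 0 < C₁ ∧ 0 < C₂ ∧ ∀ n : ℕ, 1 ≤ n →
      C₁ * (1 / (n.factorial : ℝ) * (lam * p / (mu * θ)) ^ n *
        (n : ℝ) ^ (-(v (L + 1) / (mu * θ)) - (k : ℝ))) ≤ a (L + 1 - k) n ∧
      a (L + 1 - k) n ≤ C₂ * (1 / (n.factorial : ℝ) * (lam * p / (mu * θ)) ^ n *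
        (n : ℝ) ^ (-(v (L + 1) / (mu * θ)) - (k : ℝ))) := by
  rcases hp.eq_or_lt with rfl | hp
  -- For `p = 0` all levels `n ≥ 1` are empty and `0 ^ n = 0`, so any constants serve.
  · refine ⟨1, 1, one_pos, one_pos, fun n hn => ?_⟩
    obtain ⟨n, rfl⟩ := Nat.exists_eq_add_of_le' hn
    have h0 := h.eq_zero_of_full_eq_zero hmu hθ ha (n := n) (i := L + 1 - k) (by simp) (by omega)
    simp [h0]
  obtain ⟨c₁, c₂, hc₁, hc₂, hb⟩ := h.exists_full_bounds hlam hmu hp hr0 hr1 hθ hv ha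
    (h.full_pos hlam hmu hp hr0 hθ ha hne)
  obtain ⟨d₁, hd₁, hlow⟩ := h.exists_lower hlam hmu hr0 hr1 hv hvpos ha hk
  -- `exists_upper` counts free places from `L`, hence the shift to `k - 1`.
  obtain ⟨d₂, hd₂, hup⟩ := h.exists_upper hlam hmu hp.le hr0 hθ hv ha (k := k - 1) (by omega)
  rw [show k - 1 + 1 = k by omega, show L - (k - 1) = L + 1 - k by omega] at hup
  refine ⟨d₁ * c₁, d₂ * c₂, mul_pos hd₁ hc₁, mul_pos hd₂ hc₂, fun n hn => ?_⟩
  have hn' : (0 : ℝ) < n := by exact_mod_cast hn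
  have hnk : (0 : ℝ) < n ^ k := by positivity
  rw [Real.rpow_sub hn', Real.rpow_natCast]
  obtain ⟨hb1, hb2⟩ := hb n hn
  constructor
  · rw [← mul_div_assoc, ← mul_div_assoc, div_le_iff₀ hnk]
    calc _ = d₁ * (c₁ * (1 / (n.factorial : ℝ) * (lam * p / (mu * θ)) ^ n *
        (n : ℝ) ^ (-(v (L + 1) / (mu * θ))))) := by ring
      _ ≤ d₁ * a (L + 1) n := by gcongr
      _ ≤ n ^ k * a (L + 1 - k) n := hlow n hn
      _ = _ := mul_comm _ _
  · rw [← mul_div_assoc, ← mul_div_assoc, le_div_iff₀ hnk]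
    calc a (L + 1 - k) n * n ^ k ≤ n ^ k * partialMass a (L + 1 - k) n := by
          rw [mul_comm]
          gcongr
          exact le_partialMass ha le_rfl n
      _ ≤ d₂ * a (L + 1) n := hup n hn
      _ ≤ d₂ * (c₂ * (1 / (n.factorial : ℝ) * (lam * p / (mu * θ)) ^ n *
        (n : ℝ) ^ (-(v (L + 1) / (mu * θ))))) := by gcongr
      _ = _ := by ring

end RetrialQueue.IsBalanced

theorem mainTheorem4 {K : ℕ} (m : RetrialQueue K)
    (hlam : 0 < m.lam) (hmu : 0 < m.mu)
    (hp0 : 0 ≤ m.p) (hp1 : m.p ≤ 1)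
    (hq0 : 0 ≤ m.q) (hq1 : m.q ≤ 1)
    (hr0 : 0 ≤ m.r) (hr1 : m.r ≤ 1)
    (hnu0 : m.nu 0 = 0) (hnu_mono : Monotone m.nu) (hnu_pos : ∀ i, i ≠ 0 → 0 < m.nu i)
    (hloss : 0 < (1 - m.r) + m.r * (1 - m.q))
    {Ω : Type*} [MeasurableSpace Ω] (P : Measure Ω) [IsProbabilityMeasure P]
    (ℱ : Filtration ℝ≥0 ‹MeasurableSpace Ω›) (X : ℝ≥0 → Ω → Fin (K + 1) × ℕ)
    (hX : m.IsChain P ℱ X)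
    (π : Fin (K + 1) → ℕ → ℝ) (hπ : IsLimitDistribution P X π)
    (k : ℕ) (hk1 : 1 ≤ k) (hkK : k ≤ K) :
    ∃ C₁ C₂ : ℝ, 0 < C₁ ∧ 0 < C₂ ∧ ∀ n : ℕ, 1 ≤ n →
      C₁ * (1 / (n.factorial : ℝ) * m.gamma ^ n *
          (n : ℝ) ^ (-(m.nu (Fin.last K) / (m.mu * m.lossProb)) - (k : ℝ)))
        ≤ π ⟨K - k, Nat.lt_succ_of_le (Nat.sub_le K k)⟩ n ∧
      π ⟨K - k, Nat.lt_succ_of_le (Nat.sub_le K k)⟩ n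
        ≤ C₂ * (1 / (n.factorial : ℝ) * m.gamma ^ n *
          (n : ℝ) ^ (-(m.nu (Fin.last K) / (m.mu * m.lossProb)) - (k : ℝ))) := by
  obtain ⟨L, rfl⟩ : ∃ L, K = L + 1 := Nat.exists_eq_add_of_le' (hk1.trans hkK)
  have hbal := m.isBalanced_of_sum_Q_mul_eq_zero hnu0 fun y => hX.sum_Q_mul_eq_zero hπ y
  have hπ0 : ∀ i n, 0 ≤ π i n := fun i n =>
    ge_of_tendsto' (hπ.1 i n) fun _ => measureReal_nonneg
  have hnu : ∀ i, 0 ≤ m.nu i := fun i => by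
    rcases eq_or_ne i 0 with rfl | hi
    · exact hnu0.ge
    · exact (hnu_pos i hi).le
  have hext : ∀ f : Fin (L + 2) → ℝ, (∀ i, 0 ≤ f i) → ∀ i, 0 ≤ RetrialQueue.extendFin f i := by
    intro f hf i
    unfold RetrialQueue.extendFin
    split_ifs
    · exact hf _
    · exact le_rfl
  -- Total mass `1` rules out the zero solution of the balance equations.
  have hne : ∃ i n, i ≤ L + 1 ∧ RetrialQueue.extendFin (fun j => π j n) i ≠ 0 := by
    by_contra! hall
    have h0 : ∀ x : Fin (L + 1 + 1) × ℕ, π x.1 x.2 = 0 := fun x => by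
      rw [← RetrialQueue.extendFin_val (fun j => π j x.2) x.1]
      exact hall _ _ (Nat.le_of_lt_succ x.1.2)
    have h1 := hπ.2
    simp only [h0] at h1
    exact zero_ne_one (hasSum_zero.unique h1)
  have hmain := hbal.exists_bounds hlam hmu hp0 hr0 hr1 hloss (hext _ hnu)
    (fun i hi => by
      rw [RetrialQueue.extendFin_of_lt _ (by omega)]
      exact hnu_pos _ (by simp [Fin.ext_iff]))
    (fun i n => hext _ (fun j => hπ0 j n) i) hne hk1 hkK
  simp only [RetrialQueue.extendFin_of_lt _ (show L + 1 - k < L + 1 + 1 by omega),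
    RetrialQueue.extendFin_of_lt _ (Nat.lt_succ_self (L + 1))] at hmain
  exact hmain
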